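/- **Setting.** Let $\mathbb{Y}=\{y_1,\dots,y_n\}$ be differential indeterminates over $\mathbb{Q}$ (one derivation $\delta$, trivial on $\mathbb{Q}$), and write $y_j^{(k)}=\delta^k y_j$. A Laurent differential monomial is a finite product $\prod_{j,k}(y_j^{(k)})^{d_{jk}}$ with $d_{jk}\in\mathbb{Z}$. For $i=0,\dots,n$ let $l_i\ge 1$, let $M_{i0},\dots,M_{il_i}$ be pairwise distinct Laurent differential monomials, and let $$\mathbb{P}_i=\sum_{k=0}^{l_i}u_{ik}M_{ik},\qquad \mathbf{u}_i=(u_{i0},\dots,u_{il_i}),$$ where all the $u_{ik}$ and $y_j$ together are differential indeterminates over $\mathbb{Q}$. The system is *Laurent differentially essential* if there are $1\le k_i\le l_i$ $(i=0,\dots,n)$ such that the differential field $\mathbb{Q}\langle M_{0k_0}/M_{00},\dots,M_{nk_n}/M_{n0}\rangle$ has differential transcendence degree $n$ over $\mathbb{Q}$. Let $[\mathbb{P}_0,\dots,\mathbb{P}_n]$ be the differential ideal generated by the $\mathbb{P}_i$ in the ring $\mathbb{Q}\{\mathbb{Y},\mathbb{Y}^{-1};\mathbf{u}_0,\dots,\mathbf{u}_n\}$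 of differential polynomials in the $u_{ik}$ and Laurent differential polynomials in the $y_j$ (all $y_j^{(k)}$ are invertible). The *sparse differential resultant* of a Laurent differentially essential system is the irreducible differential polynomial $\mathbf{R}\in\mathbb{Q}\{\mathbf{u}_0,\dots,\mathbf{u}_n\}$ (unique up to a nonzero rational factor) such that $$[\mathbb{P}_0,\dots,\mathbb{P}_n]\cap\mathbb{Q}\{\mathbf{u}_0,\dots,\mathbf{u}_n\}=\mathrm{sat}(\mathbf{R})$$ under any ranking, where $\mathrm{sat}(\mathbf{R})=[\mathbf{R}]:H^\infty$ and $H$ consists of the initial and the separant of $\mathbf{R}$. The order $\mathrm{ord}(f,z)$ of a differential polynomial $f$ in $z$ is the largest $k$ such that $z^{(k)}$ occurs in $f$, and $-\infty$ if no derivative of $z$ occurs; $\mathrm{ord}(\mathbf{R},\mathbf{u}_i)=\max_k\mathrm{ord}(\mathbf{R},u_{ik})$. The norm form $\mathbb{P}_i^N$ is the differential polynomial $M\cdot\mathbb{P}_i$, where $M$ is the Laurent differential monomial that clears all denominators and removes all differential monomial factors. Let $e_{ij}=\mathrm{ord}(\mathbb{P}_i^N,y_j)$ for $0\le i\le n$,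 $1\le j\le n$. Let $J_i$ be the Jacobi number (the maximum, over all permutations, of the diagonal sums, where a sum with a term $-\infty$ is $-\infty$) of the $n\times n$ matrix obtained from $(e_{ij})$ by deleting the row of index $i$. Let $\underline{o}_j$ be the smallest $k$ such that $y_j^{(k)}$ occurs in one of $\mathbb{P}_0^N,\dots,\mathbb{P}_n^N$, and $\underline{\gamma}=\sum_{j=1}^n\underline{o}_j$. **Theorem.** Let $\mathbb{P}_0,\dots,\mathbb{P}_n$ be a Laurent differentially essential system and $\mathbf{R}$ its sparse differential resultant. For every $i=0,\dots,n$: 1. if $J_i=-\infty$, then $\mathrm{ord}(\mathbf{R},\mathbf{u}_i)=-\infty$; 2. if $J_i\ge 0$, then $\mathrm{ord}(\mathbf{R},\mathbf{u}_i)\le J_i$, and moreover $\mathrm{ord}(\mathbf{R},\mathbf{u}_i)\le J_i-\underline{\gamma}$. -/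

import Mathlib

open scoped BigOperators

namespace SparseDiffRes

noncomputable section

/-! ### Differential polynomials -/

/-- The ring of differential polynomials over `A` in the differential indeterminates indexed by
`σ`; the variable `(j, k)` is the `k`-th derivative of the `j`-th indeterminate. -/
abbrev DiffPoly (σ : Type) (A : Type) [CommRing A] : Type := MvPolynomial (σ × ℕ) A

/-- The derivation of `ℚ{σ}`: it vanishes on `ℚ` and sends `y^(k)` to `y^(k+1)`. -/
def polyDeriv (σ : Type) : Derivation ℚ (DiffPoly σ ℚ) (DiffPoly σ ℚ) :=
  MvPolynomial.mkDerivation ℚ (fun v : σ × ℕ => MvPolynomial.X (v.1, v.2 + 1))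

/-- The differential ideal `[S]`: the ideal generated by all derivatives of elements of `S`. -/
def diffIdeal {R : Type} [CommRing R] [Algebra ℚ R] (δ : Derivation ℚ R R) (S : Set R) :
    Ideal R :=
  Ideal.span {f | ∃ s ∈ S, ∃ k : ℕ, f = (⇑δ)^[k] s}

/-- `ord(f, y_j)`: the largest `k` such that `y_j^(k)` occurs in `f`, and `⊥` (that is, `-∞`) if
no derivative of `y_j` occurs in `f`. -/
def ord {σ A : Type} [DecidableEq σ] [CommRing A] (f : DiffPoly σ A) (j : σ) : WithBot ℕ :=
  f.vars.sup (fun v => if v.1 = j then (v.2 : WithBot ℕ) else ⊥)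

/-! ### Rankings and saturation ideals -/

/-- A ranking on the set of all derivatives of the indeterminates `σ`: a total order (given by
its strict part) which is compatible with the derivation. -/
structure Ranking (σ : Type) where
  lt : σ × ℕ → σ × ℕ → Prop
  irrefl : ∀ v, ¬ lt v v
  trans : ∀ u v w, lt u v → lt v w → lt u w
  total : ∀ v w, lt v w ∨ v = w ∨ lt w v
  lt_deriv : ∀ v : σ × ℕ, lt v (v.1, v.2 + 1)
  deriv_lt_deriv : ∀ v w : σ × ℕ, lt v w → lt (v.1, v.2 + 1) (w.1, w.2 + 1)

/-- `v` is the leader of `f`: the greatest derivative occurring in `f`. -/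
def IsLeader {σ : Type} (r : Ranking σ) (f : DiffPoly σ ℚ) (v : σ × ℕ) : Prop :=
  v ∈ f.vars ∧ ∀ w ∈ f.vars, w ≠ v → r.lt w v

/-- The leading coefficient of `f` regarded as a univariate polynomial in the variable `v`;
for the leader `v` of `f` this is the initial of `f`. -/
def initialAt {σ : Type} (f : DiffPoly σ ℚ) (v : σ × ℕ) : DiffPoly σ ℚ :=
  ∑ m ∈ f.support with m v = f.degreeOf v, MvPolynomial.monomial (m.erase v) (f.coeff m)

/-- The saturation ideal `sat(f) = [f] : H^∞`, where `H` consists of the initial and of the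
separant of `f` with respect to the ranking `r`, as a set.  (A nonconstant `f` has exactly one
leader.) -/
def sat {σ : Type} (r : Ranking σ) (f : DiffPoly σ ℚ) : Set (DiffPoly σ ℚ) :=
  {p | ∃ v, IsLeader r f v ∧
    ∃ h ∈ Submonoid.closure {initialAt f v, MvPolynomial.pderiv v f},
      h * p ∈ diffIdeal (polyDeriv σ) {f}}

/-! ### Laurent differential polynomials -/

/-- Exponent vectors of Laurent differential monomials in `y_1, …, y_n`. -/
abbrev LaurentExp (n : ℕ) : Type := (Fin n × ℕ) →₀ ℤ

/-- The ring `A{Y, Y⁻¹}` of Laurent differential polynomials in `y_1, …, y_n`: the Laurent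
polynomials in all the `y_j^(k)`. -/
abbrev LaurentDiffPoly (n : ℕ) (A : Type) [CommRing A] : Type :=
  AddMonoidAlgebra A (LaurentExp n)

/-- The derivative `d(a) * Y ^ g + ∑ g(j,k) * a * Y ^ g * y_j^(k+1) / y_j^(k)` of the term
`a * Y ^ g`, when `d` is the derivation of the coefficients. -/
def termDeriv {n : ℕ} {A : Type} [CommRing A] [Algebra ℚ A] (d : Derivation ℚ A A)
    (g : LaurentExp n) : A →ₗ[ℚ] LaurentDiffPoly n A where
  toFun a := AddMonoidAlgebra.single g (d a) + g.sum (fun v e =>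
    AddMonoidAlgebra.single (g - Finsupp.single v 1 + Finsupp.single (v.1, v.2 + 1) 1) (e • a))
  map_add' a b := by
    simp only [map_add, smul_add, AddMonoidAlgebra.single_add, Finsupp.sum_add]
    abel
  map_smul' c a := by
    simp only [Derivation.map_smul, smul_comm _ c a, ← AddMonoidAlgebra.smul_single, smul_add,
      Finsupp.smul_sum, RingHom.id_apply]

/-- The additive map underlying the derivation of `A{Y, Y⁻¹}`. -/
def laurentDerivMap (n : ℕ) {A : Type} [CommRing A] [Algebra ℚ A] (d : Derivation ℚ A A) :
    LaurentDiffPoly n A →ₗ[ℚ] LaurentDiffPoly n A :=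
  (Finsupp.lsum ℚ (fun g => termDeriv d g)).comp
    (AddMonoidAlgebra.coeffLinearEquiv ℚ).toLinearMap

theorem laurentDerivMap_single (n : ℕ) {A : Type} [CommRing A] [Algebra ℚ A]
    (d : Derivation ℚ A A) (g : LaurentExp n) (a : A) :
    laurentDerivMap n d (AddMonoidAlgebra.single g a) = termDeriv d g a := by
  change (Finsupp.lsum ℚ (fun g => termDeriv d g)) (Finsupp.single g a) = _
  simp

theorem termDeriv_mul (n : ℕ) {A : Type} [CommRing A] [Algebra ℚ A]
    (d : Derivation ℚ A A) (g h : LaurentExp n) (a b : A) :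
    termDeriv d (g + h) (a * b) =
      AddMonoidAlgebra.single g a * termDeriv d h b +
        AddMonoidAlgebra.single h b * termDeriv d g a := by
  classical
  simp only [termDeriv, LinearMap.coe_mk, AddHom.coe_mk]
  have e0 : ((g + h).sum fun (v : Fin n × ℕ) (e : ℤ) => AddMonoidAlgebra.single
      (g + h - Finsupp.single v 1 + Finsupp.single (v.1, v.2 + 1) 1) (e • (a * b))) =
      (g.sum fun (v : Fin n × ℕ) (e : ℤ) => AddMonoidAlgebra.single
        (g + h - Finsupp.single v 1 + Finsupp.single (v.1, v.2 + 1) 1) (e • (a * b))) +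
      (h.sum fun (v : Fin n × ℕ) (e : ℤ) => AddMonoidAlgebra.single
        (g + h - Finsupp.single v 1 + Finsupp.single (v.1, v.2 + 1) 1) (e • (a * b))) :=
    Finsupp.sum_add_index' (by intro v; simp)
      (by intro v e f; simp [add_smul, AddMonoidAlgebra.single_add])
  rw [e0]
  simp only [mul_add, Finsupp.sum, Finset.mul_sum, AddMonoidAlgebra.single_mul_single,
    Derivation.leibniz, smul_eq_mul, AddMonoidAlgebra.single_add, mul_smul_comm]
  have e1 : ∀ v : Fin n × ℕ, g + (h - Finsupp.single v 1 + Finsupp.single (v.1, v.2 + 1) 1) =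
      g + h - Finsupp.single v 1 + Finsupp.single (v.1, v.2 + 1) 1 := fun v => by abel
  have e2 : ∀ v : Fin n × ℕ, h + (g - Finsupp.single v 1 + Finsupp.single (v.1, v.2 + 1) 1) =
      g + h - Finsupp.single v 1 + Finsupp.single (v.1, v.2 + 1) 1 := fun v => by abel
  simp only [e1, e2, mul_comm b a, add_comm h g]
  abel

/-- The derivation of `A{Y, Y⁻¹}` that extends the derivation `d` of `A` and sends `y_j^(k)` to
`y_j^(k+1)`. -/
def laurentDeriv (n : ℕ) {A : Type} [CommRing A] [Algebra ℚ A] (d : Derivation ℚ A A) :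
    Derivation ℚ (LaurentDiffPoly n A) (LaurentDiffPoly n A) :=
  Derivation.mk' (laurentDerivMap n d) (by
    intro x y
    simp only [smul_eq_mul]
    induction x using AddMonoidAlgebra.induction_linear with
    | zero => simp
    | add f g hf hg => rw [add_mul, map_add, hf, hg, map_add, add_mul, mul_add]; abel
    | single g a =>
      induction y using AddMonoidAlgebra.induction_linear with
      | zero => simp
      | add p q hp hq => rw [mul_add, map_add, hp, hq, map_add, add_mul, mul_add]; abel
      | single h b =>
        rw [AddMonoidAlgebra.single_mul_single, laurentDerivMap_single, laurentDerivMap_single,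
          laurentDerivMap_single, termDeriv_mul])

/-- The greatest lower bound (coordinatewise minimum) of the exponent vectors of the terms of
`F`. -/
def minExp {n : ℕ} {A : Type} [CommRing A] (F : LaurentDiffPoly n A) : LaurentExp n :=
  if h : F.coeff.support.Nonempty then F.coeff.support.inf' h id else 0

/-- The norm form of a Laurent differential polynomial: `F` is multiplied by the Laurent
differential monomial that clears all denominators and removes every differential monomial
factor. -/
def normForm {n : ℕ} {A : Type} [CommRing A] (F : LaurentDiffPoly n A) : DiffPoly (Fin n) A :=
  ∑ g ∈ F.coeff.support,
    MvPolynomial.monomial (Finsupp.mapRange Int.toNat Int.toNat_zero (g - minExp F)) (F.coeff g)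

/-! ### Differential transcendence degree -/

/-- The homomorphism `a ↦ a + d(a) ε` from a domain to the dual numbers over its fraction
field `K`. -/
def dualHom {R : Type} (K : Type) [CommRing R] [Algebra ℚ R] [Field K] [Algebra R K]
    (d : Derivation ℚ R R) : R →+* TrivSqZeroExt K K where
  toFun a := TrivSqZeroExt.inl (algebraMap R K a) + TrivSqZeroExt.inr (algebraMap R K (d a))
  map_one' := by ext <;> simp
  map_mul' a b := by
    ext
    · simp
    · simp only [TrivSqZeroExt.fst_add, TrivSqZeroExt.snd_add, TrivSqZeroExt.snd_mul,
        TrivSqZeroExt.fst_inl, TrivSqZeroExt.snd_inl, TrivSqZeroExt.fst_inr, TrivSqZeroExt.snd_inr,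
        Derivation.leibniz, smul_eq_mul, map_add, map_mul, zero_add, add_zero,
        MulOpposite.smul_eq_mul_unop, MulOpposite.unop_op]
      ring
  map_zero' := by ext <;> simp
  map_add' a b := by
    simp only [map_add, TrivSqZeroExt.inl_add, TrivSqZeroExt.inr_add]
    abel

/-- The extension of `dualHom` to the fraction field. -/
def dualLift {R : Type} (K : Type) [CommRing R] [Algebra ℚ R] [Field K] [Algebra R K]
    [IsFractionRing R K] (d : Derivation ℚ R R) : K →+* TrivSqZeroExt K K :=
  IsLocalization.lift (M := nonZeroDivisors R) (g := dualHom K d) (by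
    intro y
    rw [TrivSqZeroExt.isUnit_iff_isUnit_fst]
    simpa [dualHom] using IsLocalization.map_units K y)

theorem fst_dualLift {R : Type} (K : Type) [CommRing R] [Algebra ℚ R] [Field K] [Algebra R K]
    [IsFractionRing R K] (d : Derivation ℚ R R) (x : K) : (dualLift K d x).fst = x := by
  have h : ((TrivSqZeroExt.fstHom K K K).toRingHom.comp (dualLift K d)) = RingHom.id K := by
    apply IsLocalization.ringHom_ext (nonZeroDivisors R)
    ext a
    simp [dualLift, dualHom]
  exact congrArg (fun f => f x) h

/-- The unique extension of a derivation of a domain to a derivation of its fraction field; see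
`fracDeriv_algebraMap`. -/
def fracDeriv {R : Type} (K : Type) [CommRing R] [Algebra ℚ R] [Field K] [Algebra ℚ K]
    [Algebra R K] [IsFractionRing R K] (d : Derivation ℚ R R) : Derivation ℚ K K :=
  Derivation.mk'
    ((TrivSqZeroExt.sndHom K K).toAddMonoidHom.comp
      (dualLift K d).toAddMonoidHom).toRatLinearMap (by
    intro x y
    simp [fst_dualLift, mul_comm])

theorem fracDeriv_algebraMap {R : Type} (K : Type) [CommRing R] [Algebra ℚ R] [Field K]
    [Algebra ℚ K] [Algebra R K] [IsFractionRing R K] (d : Derivation ℚ R R) (a : R) :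
    fracDeriv K d (algebraMap R K a) = algebraMap R K (d a) := by
  change (dualLift K d (algebraMap R K a)).snd = _
  rw [dualLift, IsLocalization.lift_eq]
  change (TrivSqZeroExt.inl (algebraMap R K a) + TrivSqZeroExt.inr (algebraMap R K (d a)) :
    TrivSqZeroExt K K).snd = _
  rw [TrivSqZeroExt.snd_add, TrivSqZeroExt.snd_inl, TrivSqZeroExt.snd_inr, zero_add]

/-- The differential field `ℚ⟨Y⟩` of differential rational functions in `y_1, …, y_n`: the
fraction field of `ℚ{Y}`. -/
def DiffRat (n : ℕ) : Type := FractionRing (DiffPoly (Fin n) ℚ)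

instance (n : ℕ) : Field (DiffRat n) :=
  inferInstanceAs (Field (FractionRing (DiffPoly (Fin n) ℚ)))

instance (n : ℕ) : Algebra (DiffPoly (Fin n) ℚ) (DiffRat n) :=
  inferInstanceAs (Algebra (DiffPoly (Fin n) ℚ) (FractionRing (DiffPoly (Fin n) ℚ)))

instance (n : ℕ) : IsFractionRing (DiffPoly (Fin n) ℚ) (DiffRat n) :=
  inferInstanceAs (IsFractionRing (DiffPoly (Fin n) ℚ) (FractionRing (DiffPoly (Fin n) ℚ)))

instance (n : ℕ) : CharZero (DiffRat n) :=
  charZero_of_injective_algebraMap (IsFractionRing.injective (DiffPoly (Fin n) ℚ) (DiffRat n))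

/-- The derivation of `ℚ⟨Y⟩`. -/
def ratDeriv (n : ℕ) : Derivation ℚ (DiffRat n) (DiffRat n) :=
  fracDeriv (DiffRat n) (polyDeriv (Fin n))

/-- The Laurent differential monomial with exponent vector `g`, as an element of `ℚ⟨Y⟩`. -/
def laurentMonomial {n : ℕ} (g : LaurentExp n) : DiffRat n :=
  g.prod (fun v e => (algebraMap (DiffPoly (Fin n) ℚ) (DiffRat n) (MvPolynomial.X v)) ^ e)

/-- The smallest differential subfield `ℚ⟨S⟩` of `K` that contains `S`. -/
def diffAdjoin {K : Type} [Field K] [Algebra ℚ K] (δ : Derivation ℚ K K) (S : Set K) :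
    IntermediateField ℚ K :=
  IntermediateField.adjoin ℚ {f | ∃ s ∈ S, ∃ k : ℕ, f = (⇑δ)^[k] s}

/-- The set `Ω` is differentially independent over `ℚ`: all the derivatives of its elements are
algebraically independent over `ℚ`. -/
def DiffIndep {K : Type} [Field K] [Algebra ℚ K] (δ : Derivation ℚ K K) (Ω : Set K) : Prop :=
  AlgebraicIndependent ℚ (fun p : Ω × ℕ => (⇑δ)^[p.2] (p.1 : K))

/-- The differential transcendence degree over `ℚ` of the subfield `L` is `d`: there is a maximal
differentially independent subset of `L`, and it has `d` elements. -/
def HasDiffTrdeg {K : Type} [Field K] [Algebra ℚ K] (δ : Derivation ℚ K K)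
    (L : IntermediateField ℚ K) (d : ℕ) : Prop :=
  ∃ Ω : Set K, Maximal (fun Ω' : Set K => Ω' ⊆ (L : Set K) ∧ DiffIndep δ Ω') Ω ∧ Ω.encard = d

/-! ### Generic systems and the sparse differential resultant -/

/-- The index set of the coefficients `u_{ik}` (`0 ≤ i ≤ n`, `0 ≤ k ≤ l i`). -/
abbrev CoeffIdx {n : ℕ} (l : Fin (n + 1) → ℕ) : Type := Σ i : Fin (n + 1), Fin (l i + 1)

/-- The generic Laurent differential polynomial `ℙ_i = ∑_k u_{ik} Y ^ α_{ik}`. -/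
def genericPoly {n : ℕ} {l : Fin (n + 1) → ℕ} (α : ∀ i, Fin (l i + 1) → LaurentExp n)
    (i : Fin (n + 1)) : LaurentDiffPoly n (DiffPoly (CoeffIdx l) ℚ) :=
  ∑ k : Fin (l i + 1), AddMonoidAlgebra.single (α i k) (MvPolynomial.X (⟨i, k⟩, 0))

/-- The system is Laurent differentially essential: there are `1 ≤ k_i ≤ l_i` such that
`ℚ⟨M_{0k_0}/M_{00}, …, M_{nk_n}/M_{n0}⟩` has differential transcendence degree `n` over `ℚ`. -/
def LaurentDiffEssential {n : ℕ} {l : Fin (n + 1) → ℕ}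
    (α : ∀ i, Fin (l i + 1) → LaurentExp n) : Prop :=
  ∃ k : ∀ i, Fin (l i + 1), (∀ i, k i ≠ 0) ∧
    HasDiffTrdeg (ratDeriv n)
      (diffAdjoin (ratDeriv n)
        (Set.range fun i => laurentMonomial (α i (k i)) / laurentMonomial (α i 0))) n

/-- The elimination ideal `[ℙ_0, …, ℙ_n] ∩ ℚ{u_0, …, u_n}`, where the differential ideal is taken
in `ℚ{Y, Y⁻¹; u_0, …, u_n}`. -/
def elimIdeal {n : ℕ} {l : Fin (n + 1) → ℕ} (α : ∀ i, Fin (l i + 1) → LaurentExp n) :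
    Ideal (DiffPoly (CoeffIdx l) ℚ) :=
  (diffIdeal (laurentDeriv n (polyDeriv (CoeffIdx l))) (Set.range (genericPoly α))).comap
    (AddMonoidAlgebra.singleZeroRingHom :
      DiffPoly (CoeffIdx l) ℚ →+* LaurentDiffPoly n (DiffPoly (CoeffIdx l) ℚ))

/-- `R` is the sparse differential resultant of the system (which is unique up to a nonzero
rational factor): an irreducible differential polynomial in the coefficients such that
`[ℙ_0, …, ℙ_n] ∩ ℚ{u_0, …, u_n} = sat(R)` under any ranking. -/
def IsSparseDiffResultant {n : ℕ} {l : Fin (n + 1) → ℕ}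
    (α : ∀ i, Fin (l i + 1) → LaurentExp n) (R : DiffPoly (CoeffIdx l) ℚ) : Prop :=
  Irreducible R ∧ ∀ r : Ranking (CoeffIdx l), (elimIdeal α : Set _) = sat r R

/-- `ord(R, u_i) = max_k ord(R, u_{ik})`. -/
def ordBlock {n : ℕ} {l : Fin (n + 1) → ℕ} (R : DiffPoly (CoeffIdx l) ℚ) (i : Fin (n + 1)) :
    WithBot ℕ :=
  Finset.univ.sup (fun k : Fin (l i + 1) => ord R (⟨i, k⟩ : CoeffIdx l))

/-! ### Jacobi numbers -/

/-- The Jacobi number of a square matrix: the maximal diagonal sum. -/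
def jacobiNumber {n : ℕ} (A : Matrix (Fin n) (Fin n) (WithBot ℕ)) : WithBot ℕ :=
  Finset.univ.sup (fun σ : Equiv.Perm (Fin n) => ∑ j, A j (σ j))

/-- The order matrix `(ord(ℙ_i^N, y_j))` of the system. -/
def orderMatrix {n : ℕ} {l : Fin (n + 1) → ℕ} (α : ∀ i, Fin (l i + 1) → LaurentExp n) :
    Matrix (Fin (n + 1)) (Fin n) (WithBot ℕ) :=
  Matrix.of fun i j => ord (normForm (genericPoly α i)) j

/-- `J_i`: the Jacobi number of the order matrix with the row of index `i` deleted. -/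
def systemJacobi {n : ℕ} {l : Fin (n + 1) → ℕ} (α : ∀ i, Fin (l i + 1) → LaurentExp n)
    (i : Fin (n + 1)) : WithBot ℕ :=
  jacobiNumber ((orderMatrix α).submatrix i.succAbove id)

/-- The smallest `k` such that `y_j^(k)` occurs in some `ℙ_i^N`. -/
def minOrder {n : ℕ} {l : Fin (n + 1) → ℕ} (α : ∀ i, Fin (l i + 1) → LaurentExp n)
    (j : Fin n) : ℕ :=
  sInf {k : ℕ | ∃ i, 0 < (normForm (genericPoly α i)).degreeOf (j, k)}

end

end SparseDiffRes

/-!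
The elimination ideal `[ℙ_0, …, ℙ_n] ∩ ℚ{u_0, …, u_n}` contains every differential relation
satisfied by the generic zero, at which `u_{i0}` takes the value
`ζ_i = -∑_{k ≠ 0} u_{ik} M_{ik} / M_{i0}` (`mem_elimIdeal_of_aeval_eq_zero`). The first `H_i`
derivatives of the `ζ_i` and of the `u_{ik}`, `k ≠ 0`, lie in a ring generated, up to inverses, by
these derivatives of the `u_{ik}`, `k ≠ 0`, and by the derivatives of the `y_j` that occur. If
fewer than `∑ H_i` derivatives of the `y_j` occur, they are algebraically dependent, and the
elimination ideal contains a nonzero polynomial of order less than `H_i` in each `u_i`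
(`exists_mem_elimIdeal_of_card_lt`).

Such a polynomial bounds the order of `R`: in the elimination ranking with `u_{ik}` highest, a
nonzero polynomial of smaller order than `R` in `u_{ik}` is reduced with respect to `R`, and the
saturation ideal of an irreducible polynomial contains no such polynomial
(`ord_le_ord_of_forall_mem_sat`). To see this, the generic point of the hypersurface `R = 0` is
modified in the higher derivatives of `u_{ik}` so that it annihilates `[R]`, which is possible
because the derivatives of `R` are affine in them with the separant as slope.

It remains to choose the `H_i` for a given `i`. If `J_i = -∞`, Hall's theorem gives a set `S` of
rows, not containing `i`, which involves fewer than `|S|` columns; a large constant on `S` and `0`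
elsewhere works, and the polynomial found does not involve `u_i` (`ordBlock_eq_bot`). If `J_i` is
finite, duality for the assignment problem provides integers `p_k` for the rows `k ≠ i` and `q_j`
for the columns with `e_{kj} + p_k ≤ q_j` and `∑ q_j - ∑ p_k ≤ J_i` (`exists_potentials`).
For a large constant `c`, take `H_k = p_k + c` derivatives of the other polynomials and
`J_i - γ + 1` derivatives of `ℙ_i`, where `γ` is the sum of the smallest orders `o_j`: only the
derivatives `y_j^(t)` with `o_j ≤ t < q_j + c` occur, one less than the number of equations
(`ordBlock_le_sub`).
-/

namespace SparseDiffRes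

/-! ### Jacobi numbers: Hall violators and potentials -/

/-- Hall's marriage theorem for a square bipartite graph, as an alternative between a perfect
matching and a set of rows with too few neighbours. -/
theorem exists_perm_or_hall_violator {n : ℕ} (N : Fin n → Finset (Fin n)) :
    (∃ σ : Equiv.Perm (Fin n), ∀ k, σ k ∈ N k) ∨
      ∃ S : Finset (Fin n), (S.biUnion N).card < S.card := by
  by_cases h : ∀ S : Finset (Fin n), S.card ≤ (S.biUnion N).card
  · obtain ⟨f, hf, hfN⟩ := (Finset.all_card_le_biUnion_card_iff_exists_injective N).1 h
    exact Or.inl ⟨Equiv.ofBijective f hf.bijective_of_finite, hfN⟩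
  · push Not at h
    exact Or.inr h

theorem sum_le_jacobiNumber {n : ℕ} (A : Matrix (Fin n) (Fin n) (WithBot ℕ))
    (σ : Equiv.Perm (Fin n)) : ∑ j, A j (σ j) ≤ jacobiNumber A :=
  Finset.le_sup (f := fun σ : Equiv.Perm (Fin n) => ∑ j, A j (σ j)) (Finset.mem_univ σ)

theorem exists_violator_of_jacobiNumber_eq_bot {n : ℕ} (A : Matrix (Fin n) (Fin n) (WithBot ℕ))
    (h : jacobiNumber A = ⊥) :
    ∃ S : Finset (Fin n),
      (S.biUnion fun k => Finset.univ.filter fun j => A k j ≠ ⊥).card < S.card := by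
  refine (exists_perm_or_hall_violator _).resolve_left ?_
  rintro ⟨σ, hσ⟩
  have h1 := sum_le_jacobiNumber A σ
  rw [h, le_bot_iff, WithBot.sum_eq_bot_iff] at h1
  obtain ⟨k, -, hk⟩ := h1
  exact (Finset.mem_filter.1 (hσ k)).2 hk

/-- A finite Jacobi number is a diagonal sum of finite entries. -/
theorem exists_perm_of_jacobiNumber_eq {n : ℕ} {A : Matrix (Fin n) (Fin n) (WithBot ℕ)} {J : ℕ}
    (h : jacobiNumber A = J) :
    ∃ (σ : Equiv.Perm (Fin n)) (e : Fin n → ℕ), (∀ k, A k (σ k) = e k) ∧ ∑ k, e k = J := by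
  obtain ⟨σ, -, hσ⟩ := Finset.exists_mem_eq_sup Finset.univ Finset.univ_nonempty
    (fun σ : Equiv.Perm (Fin n) => ∑ j, A j (σ j))
  change jacobiNumber A = _ at hσ
  rw [h] at hσ
  have hfin : ∀ k, A k (σ k) ≠ ⊥ := by
    intro k hk
    have : ∑ j, A j (σ j) = ⊥ := WithBot.sum_eq_bot_iff.2 ⟨k, Finset.mem_univ k, hk⟩
    rw [this] at hσ
    exact WithBot.coe_ne_bot hσ
  choose e he using fun k => WithBot.ne_bot_iff_exists.1 (hfin k)
  refine ⟨σ, e, fun k => (he k).symm, ?_⟩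
  simp only [← he, ← WithBot.coe_sum] at hσ
  exact (WithBot.coe_injective hσ).symm

/-- Duality for the assignment problem: if the Jacobi number of `A` is finite, there are integer
potentials `p` of the rows and `q` of the columns whose value `∑ q - ∑ p` does not exceed it. -/
theorem exists_potentials {n : ℕ} {A : Matrix (Fin n) (Fin n) (WithBot ℕ)} {J : ℕ}
    (h : jacobiNumber A = J) :
    ∃ p q : Fin n → ℤ, (∀ k j (e : ℕ), A k j = e → e + p k ≤ q j) ∧
      ∑ j, q j ≤ ∑ k, p k + J := by
  classical
  -- induction on a bound `d` for the excess of the value over `J`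
  have key : ∀ (d : ℕ) (p q : Fin n → ℤ), (∀ k j (e : ℕ), A k j = e → e + p k ≤ q j) →
      ∑ j, q j ≤ ∑ k, p k + J + d → ∃ p q : Fin n → ℤ,
        (∀ k j (e : ℕ), A k j = e → e + p k ≤ q j) ∧ ∑ j, q j ≤ ∑ k, p k + J := by
    intro d
    induction d with
    | zero => exact fun p q h1 h2 => ⟨p, q, h1, by simpa using h2⟩
    | succ d ih =>
      intro p q hpq hval
      -- the graph of the tight pairs
      rcases exists_perm_or_hall_violator
        (fun k => Finset.univ.filter fun j => ∃ e : ℕ, A k j = e ∧ (e : ℤ) + p k = q j) with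
        ⟨τ, hτ⟩ | ⟨S, hS⟩
      · -- on a perfect matching of tight pairs the value is a diagonal sum
        refine ⟨p, q, hpq, ?_⟩
        choose f hf hf' using fun k => (Finset.mem_filter.1 (hτ k)).2
        have h1 := sum_le_jacobiNumber A τ
        simp only [hf, h] at h1
        have h2 : ∑ k, f k ≤ J := by exact_mod_cast h1
        rw [← Equiv.sum_comp τ q, ← Finset.sum_congr rfl (fun k _ => hf' k),
          Finset.sum_add_distrib]
        have h3 : ∑ k, (f k : ℤ) ≤ J := by exact_mod_cast h2
        linarith
      · -- raising the potentials on a violator and on its neighbours lowers the value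
        set T := S.biUnion fun k =>
          Finset.univ.filter fun j => ∃ e : ℕ, A k j = e ∧ (e : ℤ) + p k = q j with hT
        refine ih (fun k => p k + if k ∈ S then 1 else 0) (fun j => q j + if j ∈ T then 1 else 0)
          ?_ ?_
        · intro k j e he
          have h1 := hpq k j e he
          by_cases hk : k ∈ S
          · by_cases hj : j ∈ T
            · simp only [hk, hj, if_true]
              linarith
            · have h2 : (e : ℤ) + p k ≠ q j := fun h2 => hj (Finset.mem_biUnion.2
                ⟨k, hk, Finset.mem_filter.2 ⟨Finset.mem_univ j, e, he, h2⟩⟩)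
              simp only [hk, hj, if_true, if_false]
              omega
          · simp only [hk, if_false]
            split_ifs <;> omega
        · simp only [Finset.sum_add_distrib, Finset.sum_ite_mem, Finset.univ_inter,
            Finset.sum_const, nsmul_eq_mul, mul_one]
          push_cast at hval
          have : (T.card : ℤ) + 1 ≤ S.card := by exact_mod_cast hS
          linarith
  -- the column maxima and zero row potentials are admissible
  refine key (∑ j, ((Finset.univ.sup fun k => (A k j).unbotD 0) : ℕ)) 0
    (fun j => ((Finset.univ.sup fun k => (A k j).unbotD 0 : ℕ) : ℤ)) ?_ ?_
  · intro k j e he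
    have h1 := Finset.le_sup (f := fun k => (A k j).unbotD 0) (Finset.mem_univ k)
    simp only [he] at h1
    change e ≤ _ at h1
    simpa using Int.ofNat_le.2 h1
  · push_cast
    simp

/-! ### Reduction modulo an irreducible differential polynomial -/

/-- A derivation maps the subalgebra generated by `s` into every subalgebra that contains `s` and
the derivatives of the elements of `s`. -/
theorem derivation_mem_of_mem_adjoin {k A : Type*} [CommRing k] [CommRing A] [Algebra k A]
    (D : Derivation k A A) {T : Subalgebra k A} {s : Set A} (hs : s ⊆ T) (hD : ∀ x ∈ s, D x ∈ T)
    {x : A} (hx : x ∈ Algebra.adjoin k s) : D x ∈ T := by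
  have hle : Algebra.adjoin k s ≤ T := Algebra.adjoin_le hs
  induction hx using Algebra.adjoin_induction with
  | mem x hx => exact hD x hx
  | algebraMap r => simp
  | add x y _ _ hx hy => rw [map_add]; exact add_mem hx hy
  | mul x y hx' hy' hx hy =>
    rw [Derivation.leibniz, smul_eq_mul, smul_eq_mul]
    exact add_mem (mul_mem (hle hx') hy) (mul_mem (hle hy') hx)

@[simp]
theorem polyDeriv_X {σ : Type} (v : σ × ℕ) :
    polyDeriv σ (MvPolynomial.X v) = MvPolynomial.X (v.1, v.2 + 1) := by
  simp [polyDeriv]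

/-- The derivatives of the indeterminates in which `w` is differentiated at most `N` times. -/
def lowOrd {σ : Type} (w : σ) (N : ℕ) : Set (σ × ℕ) := {v | v.1 = w → v.2 ≤ N}

theorem lowOrd_mono {σ : Type} (w : σ) {M N : ℕ} (h : M ≤ N) : lowOrd w M ⊆ lowOrd w N :=
  fun _ hv e => (hv e).trans h

/-- If `f` has order at most `N` in `w`, its derivative is affine in `w^(N+1)` with slope
`∂f/∂w^(N)`. -/
theorem polyDeriv_sub_mem_supported {σ : Type} {w : σ} {N : ℕ} {f : DiffPoly σ ℚ}
    (hf : f ∈ MvPolynomial.supported ℚ (lowOrd w N)) :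
    polyDeriv σ f - MvPolynomial.X (w, N + 1) * MvPolynomial.pderiv (w, N) f ∈
      MvPolynomial.supported ℚ (lowOrd w N) := by
  classical
  rw [MvPolynomial.supported_eq_adjoin_X] at hf
  refine derivation_mem_of_mem_adjoin
    (polyDeriv σ - (MvPolynomial.X (w, N + 1) : DiffPoly σ ℚ) • MvPolynomial.pderiv (w, N))
    ?_ ?_ hf
  · rintro _ ⟨v, hv, rfl⟩
    exact (MvPolynomial.X_mem_supported).2 hv
  · rintro _ ⟨v, hv, rfl⟩
    simp only [Derivation.sub_apply, Derivation.smul_apply, polyDeriv_X, smul_eq_mul]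
    by_cases h : v = (w, N)
    · subst h
      simp
    · rw [MvPolynomial.pderiv_X_of_ne h, mul_zero, sub_zero, MvPolynomial.X_mem_supported]
      intro e
      have h1 := hv e
      have h2 : v.2 ≠ N := fun h2 => h (Prod.ext e h2)
      change v.2 + 1 ≤ N
      omega

theorem pderiv_mem_supported {τ : Type} {s : Set τ} (v : τ) {f : MvPolynomial τ ℚ}
    (hf : f ∈ MvPolynomial.supported ℚ s) :
    MvPolynomial.pderiv v f ∈ MvPolynomial.supported ℚ s := by
  classical
  rw [MvPolynomial.supported_eq_adjoin_X] at hf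
  refine derivation_mem_of_mem_adjoin (MvPolynomial.pderiv v) ?_ ?_ hf
  · rintro _ ⟨u, hu, rfl⟩
    exact (MvPolynomial.X_mem_supported).2 hu
  · rintro _ ⟨u, hu, rfl⟩
    rw [MvPolynomial.pderiv_X]
    by_cases h : u = v
    · subst h; simp
    · simp [h]

theorem polyDeriv_mem_supported {σ : Type} {w : σ} {N : ℕ} {f : DiffPoly σ ℚ}
    (hf : f ∈ MvPolynomial.supported ℚ (lowOrd w N)) :
    polyDeriv σ f ∈ MvPolynomial.supported ℚ (lowOrd w (N + 1)) := by
  have hle := MvPolynomial.supported_mono (R := ℚ) (lowOrd_mono w (Nat.le_succ N))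
  have h := add_mem (hle (polyDeriv_sub_mem_supported hf))
    (mul_mem ((MvPolynomial.X_mem_supported (R := ℚ)).2
      (show (w, N + 1) ∈ lowOrd w (N + 1) from fun _ => le_rfl))
      (hle (pderiv_mem_supported (w, N) hf)))
  simpa using h

/-- The proper derivatives of `f` are affine in the highest derivative of `w`, with the separant
as slope. -/
theorem iterate_polyDeriv_sub_mem_supported {σ : Type} {w : σ} {s : ℕ} {f : DiffPoly σ ℚ}
    (hf : f ∈ MvPolynomial.supported ℚ (lowOrd w s)) (j : ℕ) :
    (polyDeriv σ)^[j + 1] f - MvPolynomial.X (w, s + j + 1) * MvPolynomial.pderiv (w, s) f ∈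
      MvPolynomial.supported ℚ (lowOrd w (s + j)) := by
  induction j with
  | zero => simpa using polyDeriv_sub_mem_supported hf
  | succ j ih =>
    have h1 := polyDeriv_mem_supported ih
    rw [map_sub, Derivation.leibniz, polyDeriv_X, smul_eq_mul, smul_eq_mul,
      ← Function.iterate_succ_apply' (f := polyDeriv σ)] at h1
    have h2 := MvPolynomial.supported_mono (R := ℚ) (lowOrd_mono w (show s + 1 ≤ s + (j + 1) by omega))
      (polyDeriv_mem_supported (pderiv_mem_supported (w, s) hf))
    have h3 := add_mem h1 (mul_mem ((MvPolynomial.X_mem_supported (R := ℚ)).2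
      (show (w, s + j + 1) ∈ lowOrd w (s + (j + 1)) from fun _ => by
        change s + j + 1 ≤ s + (j + 1); omega)) h2)
    have h4 : ∀ a b c d : DiffPoly σ ℚ, a - b * c = a - (d + c * b) + d := fun a b c d => by ring
    rw [h4 _ _ _ (MvPolynomial.X (w, s + j + 1) *
      polyDeriv σ (MvPolynomial.pderiv (w, s) f))]
    exact h3

theorem aeval_eq_of_mem_supported {τ K : Type*} [CommRing K] [Algebra ℚ K] {s : Set τ}
    {a b : τ → K} (hab : ∀ v ∈ s, a v = b v) {f : MvPolynomial τ ℚ}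
    (hf : f ∈ MvPolynomial.supported ℚ s) : MvPolynomial.aeval a f = MvPolynomial.aeval b f := by
  rw [MvPolynomial.supported_eq_adjoin_X] at hf
  have h := AlgHom.adjoin_le_equalizer (MvPolynomial.aeval (R := ℚ) a)
    (MvPolynomial.aeval (R := ℚ) b) (s := MvPolynomial.X '' s) (by
      rintro _ ⟨v, hv, rfl⟩
      simpa using hab v hv)
  exact h hf

/-- A point at which the separant of `f` does not vanish can be changed in the derivatives of `w`
of order above `s` so that all proper derivatives of `f` vanish at it. -/
theorem exists_point_iterate_polyDeriv_eq_zero {σ : Type} {w : σ} {s : ℕ} {f : DiffPoly σ ℚ}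
    (hf : f ∈ MvPolynomial.supported ℚ (lowOrd w s)) {K : Type*} [Field K] [Algebra ℚ K]
    (a : σ × ℕ → K) (ha : MvPolynomial.aeval a (MvPolynomial.pderiv (w, s) f) ≠ 0) :
    ∃ b : σ × ℕ → K, (∀ v ∈ lowOrd w s, b v = a v) ∧
      ∀ j, MvPolynomial.aeval b ((polyDeriv σ)^[j + 1] f) = 0 := by
  classical
  set S := MvPolynomial.pderiv (w, s) f with hS
  have hSs : S ∈ MvPolynomial.supported ℚ (lowOrd w s) := pderiv_mem_supported _ hf
  -- `c j` is the point after the values of `w^(s+1), …, w^(s+j)` have been changed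
  let T : ℕ → DiffPoly σ ℚ := fun j =>
    (polyDeriv σ)^[j + 1] f - MvPolynomial.X (w, s + j + 1) * S
  let c : ℕ → (σ × ℕ → K) := fun j => Nat.rec a (fun j c =>
    Function.update c (w, s + j + 1) (-(MvPolynomial.aeval c (T j)) / MvPolynomial.aeval a S)) j
  have hc : ∀ j, c (j + 1) = Function.update (c j) (w, s + j + 1)
      (-(MvPolynomial.aeval (c j) (T j)) / MvPolynomial.aeval a S) := fun j => rfl
  have stab : ∀ j d, ∀ v ∈ lowOrd w (s + j), c (j + d) v = c j v := by
    intro j d v hv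
    induction d with
    | zero => rfl
    | succ d ih =>
      rw [← add_assoc, hc, Function.update_of_ne, ih]
      rintro rfl
      have := hv rfl
      simp only at this
      omega
  have hb : ∀ j, ∀ v ∈ lowOrd w (s + j), c v.2 v = c j v := by
    intro j v hv
    rcases le_total j v.2 with h | h
    · obtain ⟨d, hd⟩ := Nat.exists_eq_add_of_le h
      rw [hd]
      exact stab j d v hv
    · obtain ⟨d, hd⟩ := Nat.exists_eq_add_of_le h
      rw [hd]
      exact (stab v.2 d v (fun _ => Nat.le_add_left _ _)).symm
  refine ⟨fun v => c v.2 v, fun v hv => hb 0 v hv, fun j => ?_⟩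
  have e1 : (polyDeriv σ)^[j + 1] f = T j + MvPolynomial.X (w, s + j + 1) * S := by
    simp [T]
  rw [e1, map_add, map_mul, MvPolynomial.aeval_X,
    aeval_eq_of_mem_supported (hb j) (iterate_polyDeriv_sub_mem_supported hf j),
    aeval_eq_of_mem_supported (hb 0) hSs, hb (j + 1) (w, s + j + 1) (fun _ => le_rfl), hc,
    Function.update_self]
  change _ + _ * MvPolynomial.aeval a S = 0
  rw [div_mul_cancel₀ _ ha]
  exact add_neg_cancel _

theorem degreeOf_pderiv_lt {τ : Type} {f : MvPolynomial τ ℚ} {v : τ}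
    (hf : 0 < f.degreeOf v) : (MvPolynomial.pderiv v f).degreeOf v < f.degreeOf v := by
  classical
  rw [MvPolynomial.degreeOf_lt_iff hf]
  intro m hm
  rw [MvPolynomial.mem_support_iff, MvPolynomial.coeff_pderiv] at hm
  have h1 : m + Finsupp.single v 1 ∈ f.support :=
    MvPolynomial.mem_support_iff.2 (left_ne_zero_of_mul hm)
  have := MvPolynomial.monomial_le_degreeOf v h1
  simp at this
  omega

theorem pderiv_ne_zero {τ : Type} {f : MvPolynomial τ ℚ} {v : τ} (hf : v ∈ f.vars) :
    MvPolynomial.pderiv v f ≠ 0 := by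
  classical
  obtain ⟨m, hm, hv⟩ := (MvPolynomial.mem_vars_iff_mem_support _).1 hf
  intro h0
  have h1 := MvPolynomial.coeff_pderiv f (i := v) (m := m - Finsupp.single v 1)
  have h2 : m - Finsupp.single v 1 + Finsupp.single v 1 = m :=
    tsub_add_cancel_of_le (Finsupp.single_le_iff.2
      (Nat.one_le_iff_ne_zero.2 (Finsupp.mem_support_iff.1 hv)))
  rw [h0, h2, MvPolynomial.coeff_zero] at h1
  refine (mul_ne_zero (MvPolynomial.mem_support_iff.1 hm) ?_) h1.symm
  positivity

theorem coeff_initialAt {σ : Type} (f : DiffPoly σ ℚ) (v : σ × ℕ) {m : σ × ℕ →₀ ℕ}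
    (hm : m ∈ f.support) (hv : m v = f.degreeOf v) :
    (initialAt f v).coeff (m.erase v) = f.coeff m := by
  classical
  rw [initialAt, MvPolynomial.coeff_sum, Finset.sum_eq_single m]
  · simp
  · intro m' hm' hne
    rw [MvPolynomial.coeff_monomial, if_neg]
    intro he
    refine hne ?_
    rw [← Finsupp.erase_add_single v m', ← Finsupp.erase_add_single v m, he,
      (Finset.mem_filter.1 hm').2, hv]
  · intro h
    exact absurd (Finset.mem_filter.2 ⟨hm, hv⟩) h

theorem initialAt_ne_zero {σ : Type} {f : DiffPoly σ ℚ} (hf : f ≠ 0) (v : σ × ℕ) :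
    initialAt f v ≠ 0 := by
  classical
  obtain ⟨m, hm, hmax⟩ := Finset.exists_mem_eq_sup f.support (MvPolynomial.support_nonempty.2 hf)
    (fun m => m v)
  rw [← MvPolynomial.degreeOf_eq_sup] at hmax
  intro h0
  have := coeff_initialAt f v hm hmax.symm
  rw [h0, MvPolynomial.coeff_zero] at this
  exact MvPolynomial.mem_support_iff.1 hm this.symm

theorem degreeOf_initialAt {σ : Type} (f : DiffPoly σ ℚ) (v : σ × ℕ) :
    (initialAt f v).degreeOf v = 0 := by
  classical
  rw [← Nat.le_zero, initialAt]
  refine (MvPolynomial.degreeOf_sum_le v _ _).trans (Finset.sup_le fun m _ => ?_)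
  rw [MvPolynomial.degreeOf_le_iff]
  intro m' hm'
  have := MvPolynomial.support_monomial_subset hm'
  rw [Finset.mem_singleton.1 this]
  simp

theorem initialAt_mem_supported {σ : Type} {s : Set (σ × ℕ)} {f : DiffPoly σ ℚ}
    (hf : f ∈ MvPolynomial.supported ℚ s) (v : σ × ℕ) :
    initialAt f v ∈ MvPolynomial.supported ℚ s := by
  classical
  refine sum_mem fun m hm => ?_
  rw [MvPolynomial.mem_supported] at hf ⊢
  intro u hu
  refine hf ((MvPolynomial.mem_vars_iff_mem_support _).2 ⟨m, (Finset.mem_filter.1 hm).1, ?_⟩)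
  rw [Finset.mem_coe, MvPolynomial.vars_monomial
    (MvPolynomial.mem_support_iff.1 (Finset.mem_filter.1 hm).1), Finsupp.support_erase] at hu
  exact Finset.mem_of_mem_erase hu

theorem not_dvd_of_degreeOf_lt {τ : Type} {f g : MvPolynomial τ ℚ} (hg : g ≠ 0) {v : τ}
    (h : g.degreeOf v < f.degreeOf v) : ¬ f ∣ g := by
  rintro ⟨c, rfl⟩
  have := MvPolynomial.degreeOf_mul_eq (n := v) (left_ne_zero_of_mul hg) (right_ne_zero_of_mul hg)
  omega

theorem le_ord {σ A : Type} [DecidableEq σ] [CommRing A] {f : DiffPoly σ A} {v : σ × ℕ}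
    (hv : v ∈ f.vars) : ((v.2 : ℕ) : WithBot ℕ) ≤ ord f v.1 := by
  have h := Finset.le_sup (f := fun u : σ × ℕ => if u.1 = v.1 then (u.2 : WithBot ℕ) else ⊥) hv
  simp only [if_true] at h
  exact h

theorem mem_vars_of_ord_eq {σ A : Type} [DecidableEq σ] [CommRing A] {f : DiffPoly σ A} {w : σ}
    {s : ℕ} (h : ord f w = (s : WithBot ℕ)) : (w, s) ∈ f.vars := by
  have hne : f.vars.Nonempty := by
    rw [Finset.nonempty_iff_ne_empty]
    intro h0
    rw [ord, h0, Finset.sup_empty] at h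
    exact WithBot.bot_ne_coe h
  obtain ⟨v, hv, hsup⟩ := Finset.exists_mem_eq_sup f.vars hne
    (fun v => if v.1 = w then (v.2 : WithBot ℕ) else ⊥)
  change ord f w = _ at hsup
  rw [h] at hsup
  split_ifs at hsup with hw
  · rwa [← hw, show s = v.2 from WithBot.coe_injective hsup]
  · exact absurd hsup WithBot.coe_ne_bot

/-- The elimination ranking in which `w` is higher than all other indeterminates. -/
def elimRanking {σ : Type} (e : σ → ℕ) (he : Function.Injective e) (w : σ) : Ranking σ := by
  classical
  exact
  { lt := fun u v => toLex ((if u.1 = w then 1 else 0 : ℕ), toLex (u.2, e u.1)) <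
      toLex ((if v.1 = w then 1 else 0 : ℕ), toLex (v.2, e v.1))
    irrefl := fun v => lt_irrefl _
    trans := fun u v w => lt_trans
    total := fun u v => by
      rcases lt_trichotomy (toLex ((if u.1 = w then 1 else 0 : ℕ), toLex (u.2, e u.1)))
        (toLex ((if v.1 = w then 1 else 0 : ℕ), toLex (v.2, e v.1))) with h | h | h
      · exact Or.inl h
      · have h1 := congrArg (fun x => (ofLex (ofLex x).2)) h
        simp only [ofLex_toLex, Prod.mk.injEq] at h1
        exact Or.inr (Or.inl (Prod.ext (he h1.2) h1.1))
      · exact Or.inr (Or.inr h)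
    lt_deriv := fun v => by
      simp [Prod.Lex.toLex_lt_toLex]
    deriv_lt_deriv := fun u v h => by
      simpa [Prod.Lex.toLex_lt_toLex] using h }

/-- In the elimination ranking of `w`, the leader of a polynomial of order `s` in `w` is
`w^(s)`. -/
theorem eq_of_isLeader_elimRanking {σ : Type} {e : σ → ℕ} {he : Function.Injective e}
    {w : σ} {f : DiffPoly σ ℚ} {v : σ × ℕ} (hv : IsLeader (elimRanking e he w) f v) {s : ℕ}
    (hs : (w, s) ∈ f.vars) (hmax : ∀ u ∈ f.vars, u.1 = w → u.2 ≤ s) : v = (w, s) := by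
  by_contra hne
  have h := hv.2 _ hs (Ne.symm hne)
  simp only [elimRanking, Prod.Lex.toLex_lt_toLex] at h
  by_cases hw : v.1 = w
  · have := hmax v hv.1 hw
    have h2 : v.2 ≠ s := fun h2 => hne (Prod.ext hw h2)
    simp [hw] at h
    omega
  · simp [hw] at h

/-- A nonzero element of sat(`R`) for an irreducible `R` has at least the order of `R` in each
indeterminate `w`: with `w` ranked highest, a nonzero polynomial of smaller order in `w` would be
reduced with respect to `R`. -/
theorem ord_le_ord_of_forall_mem_sat {σ : Type} [DecidableEq σ] [Countable σ] {R f : DiffPoly σ ℚ}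
    (hR : Irreducible R) (hf : f ≠ 0) (hsat : ∀ r : Ranking σ, f ∈ sat r R) (w : σ) :
    ord R w ≤ ord f w := by
  by_contra hlt
  rw [not_le] at hlt
  obtain ⟨s, hs⟩ := WithBot.ne_bot_iff_exists.1 (bot_le.trans_lt hlt).ne'
  have hmax : ∀ u ∈ R.vars, u.1 = w → u.2 ≤ s := by
    rintro u hu rfl
    exact WithBot.coe_le_coe.1 ((le_ord hu).trans_eq hs.symm)
  have hmem : (w, s) ∈ R.vars := mem_vars_of_ord_eq hs.symm
  have hfmax : ∀ u ∈ f.vars, u.1 = w → u.2 < s := by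
    rintro u hu rfl
    exact WithBot.coe_lt_coe.1 ((le_ord hu).trans_lt (hlt.trans_eq hs.symm))
  obtain ⟨e, he⟩ := Countable.exists_injective_nat σ
  obtain ⟨v, hv, h, hh, hideal⟩ := hsat (elimRanking e he w)
  obtain rfl := eq_of_isLeader_elimRanking hv hmem hmax
  have hRs : R ∈ MvPolynomial.supported ℚ (lowOrd w s) :=
    MvPolynomial.mem_supported.2 fun u hu => hmax u hu
  have hfs : f ∈ MvPolynomial.supported ℚ (lowOrd w s) :=
    MvPolynomial.mem_supported.2 fun u hu hw => (hfmax u hu hw).le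
  have hdeg : 0 < R.degreeOf (w, s) := by
    obtain ⟨m, hm, hmv⟩ := (MvPolynomial.mem_vars_iff_mem_support _).1 hmem
    exact (Nat.pos_of_ne_zero (Finsupp.mem_support_iff.1 hmv)).trans_le
      (MvPolynomial.monomial_le_degreeOf _ hm)
  -- `a` is the generic point of the hypersurface `R = 0`
  have hprime : (Ideal.span {R}).IsPrime :=
    (Ideal.span_singleton_prime hR.ne_zero).2 hR.prime
  let Q := DiffPoly σ ℚ ⧸ Ideal.span {R}
  let K := FractionRing Q
  let φ : DiffPoly σ ℚ →ₐ[ℚ] K :=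
    (IsScalarTower.toAlgHom ℚ Q K).comp (Ideal.Quotient.mkₐ ℚ (Ideal.span {R}))
  have hφ : ∀ x, φ x = 0 ↔ R ∣ x := by
    intro x
    rw [← Ideal.mem_span_singleton, ← Ideal.Quotient.eq_zero_iff_mem]
    exact map_eq_zero_iff (algebraMap Q K) (IsFractionRing.injective Q K)
  let a : σ × ℕ → K := fun u => φ (MvPolynomial.X u)
  have ha : ∀ x, MvPolynomial.aeval a x = φ x := fun x =>
    congrArg (fun ψ : DiffPoly σ ℚ →ₐ[ℚ] K => ψ x)
      (MvPolynomial.algHom_ext (by simp [a]) : MvPolynomial.aeval a = φ)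
  have hsep : φ (MvPolynomial.pderiv (w, s) R) ≠ 0 := fun h0 =>
    not_dvd_of_degreeOf_lt (pderiv_ne_zero hmem) (degreeOf_pderiv_lt hdeg) ((hφ _).1 h0)
  have hini : φ (initialAt R (w, s)) ≠ 0 := fun h0 =>
    not_dvd_of_degreeOf_lt (initialAt_ne_zero hR.ne_zero _)
      (by rwa [degreeOf_initialAt]) ((hφ _).1 h0)
  obtain ⟨b, hba, hb⟩ := exists_point_iterate_polyDeriv_eq_zero hRs a (by rwa [ha])
  have hφb : ∀ x ∈ MvPolynomial.supported ℚ (lowOrd w s), MvPolynomial.aeval b x = φ x :=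
    fun x hx => by rw [aeval_eq_of_mem_supported hba hx, ha]
  have hbR : ∀ x ∈ diffIdeal (polyDeriv σ) {R}, MvPolynomial.aeval b x = 0 := by
    intro x hx
    have hle : diffIdeal (polyDeriv σ) {R} ≤ RingHom.ker (MvPolynomial.aeval (R := ℚ) b) := by
      refine Ideal.span_le.2 ?_
      rintro _ ⟨_, hS, k, rfl⟩
      rw [Set.mem_singleton_iff.1 hS]
      cases k with
      | zero =>
        change MvPolynomial.aeval b R = 0
        rw [hφb R hRs, hφ]
      | succ j => exact hb j
    exact hle hx
  have hne : MvPolynomial.aeval b h ≠ 0 := by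
    have hle : Submonoid.closure {initialAt R (w, s), MvPolynomial.pderiv (w, s) R} ≤
        (nonZeroDivisors K).comap (MvPolynomial.aeval (R := ℚ) b) := by
      refine (Submonoid.closure_le).2 ?_
      rintro x (rfl | rfl)
      · refine mem_nonZeroDivisors_of_ne_zero ?_
        rwa [hφb _ (initialAt_mem_supported hRs _)]
      · refine mem_nonZeroDivisors_of_ne_zero ?_
        rwa [hφb _ (pderiv_mem_supported _ hRs)]
    exact nonZeroDivisors.ne_zero (hle hh)
  have h0 := hbR _ hideal
  rw [map_mul, mul_eq_zero, or_iff_right hne, hφb f hfs, hφ] at h0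
  refine not_dvd_of_degreeOf_lt hf (v := (w, s)) ?_ h0
  refine lt_of_le_of_lt ?_ hdeg
  rw [MvPolynomial.degreeOf_le_iff]
  intro m hm
  by_contra hpos
  exact lt_irrefl _ (hfmax (w, s) ((MvPolynomial.mem_vars_iff_mem_support _).2
    ⟨m, hm, Finsupp.mem_support_iff.2 fun h0 => hpos h0.le⟩) rfl)

/-! ### Transcendence degrees of rings of Laurent differential polynomials -/

/-- The subalgebra of `ℚ{Y, Y⁻¹; u_0, …, u_n}` generated by the derivatives of the `u_{ik}` in `U`
and by the Laurent monomials in the derivatives of the `y_j` in `V`. -/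
noncomputable def laurentSub {n : ℕ} {σ : Type} (U : Set (σ × ℕ)) (V : Set (Fin n × ℕ)) :
    Subalgebra ℚ (LaurentDiffPoly n (DiffPoly σ ℚ)) :=
  Algebra.adjoin ℚ ((fun w => AddMonoidAlgebra.single 0 (MvPolynomial.X w)) '' U ∪
    (fun g => AddMonoidAlgebra.single g 1) '' {g | ∀ v, g v ≠ 0 → v ∈ V})

section

variable {n : ℕ} {σ : Type} {U U' : Set (σ × ℕ)} {V V' : Set (Fin n × ℕ)}

theorem single_X_mem_laurentSub {w : σ × ℕ} (hw : w ∈ U) :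
    (AddMonoidAlgebra.single 0 (MvPolynomial.X w) : LaurentDiffPoly n (DiffPoly σ ℚ)) ∈
      laurentSub U V :=
  Algebra.subset_adjoin (Or.inl ⟨w, hw, rfl⟩)

theorem single_one_mem_laurentSub {g : LaurentExp n} (hg : ∀ v, g v ≠ 0 → v ∈ V) :
    (AddMonoidAlgebra.single g 1 : LaurentDiffPoly n (DiffPoly σ ℚ)) ∈ laurentSub U V :=
  Algebra.subset_adjoin (Or.inr ⟨g, hg, rfl⟩)

theorem laurentSub_mono (hU : U ⊆ U') (hV : V ⊆ V') : laurentSub U V ≤ laurentSub U' V' := by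
  refine Algebra.adjoin_le ?_
  rintro _ (⟨w, hw, rfl⟩ | ⟨g, hg, rfl⟩)
  · exact single_X_mem_laurentSub (hU hw)
  · exact single_one_mem_laurentSub fun v hv => hV (hg v hv)

theorem laurentDeriv_single {A : Type} [CommRing A] [Algebra ℚ A] (d : Derivation ℚ A A)
    (g : LaurentExp n) (a : A) :
    laurentDeriv n d (AddMonoidAlgebra.single g a) = termDeriv d g a :=
  laurentDerivMap_single n d g a

theorem laurentDeriv_single_zero {A : Type} [CommRing A] [Algebra ℚ A] (d : Derivation ℚ A A)
    (a : A) : laurentDeriv n d (AddMonoidAlgebra.single 0 a) = AddMonoidAlgebra.single 0 (d a) := by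
  rw [laurentDeriv_single]
  simp [termDeriv]

theorem iterate_laurentDeriv_single_zero {A : Type} [CommRing A] [Algebra ℚ A]
    (d : Derivation ℚ A A) (a : A) (m : ℕ) :
    (laurentDeriv n d)^[m] (AddMonoidAlgebra.single 0 a) =
      AddMonoidAlgebra.single 0 (d^[m] a) := by
  induction m with
  | zero => rfl
  | succ m ih => rw [Function.iterate_succ_apply', ih, laurentDeriv_single_zero,
      ← Function.iterate_succ_apply' (f := d)]

theorem iterate_polyDeriv_X (i : σ) (m : ℕ) :
    (polyDeriv σ)^[m] (MvPolynomial.X (i, 0)) = MvPolynomial.X (i, m) := by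
  induction m with
  | zero => rfl
  | succ m ih => rw [Function.iterate_succ_apply', ih, polyDeriv_X]

theorem laurentDeriv_mem_laurentSub (hU : U ⊆ U') (hV : V ⊆ V')
    (hU' : ∀ w ∈ U, (w.1, w.2 + 1) ∈ U') (hV' : ∀ v ∈ V, (v.1, v.2 + 1) ∈ V')
    {x : LaurentDiffPoly n (DiffPoly σ ℚ)} (hx : x ∈ laurentSub U V) :
    laurentDeriv n (polyDeriv σ) x ∈ laurentSub U' V' := by
  refine derivation_mem_of_mem_adjoin _
    (Algebra.subset_adjoin.trans (laurentSub_mono hU hV)) ?_ hx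
  rintro _ (⟨w, hw, rfl⟩ | ⟨g, hg, rfl⟩)
  · rw [laurentDeriv_single_zero, polyDeriv_X]
    exact single_X_mem_laurentSub (hU' w hw)
  · rw [laurentDeriv_single]
    simp only [termDeriv, LinearMap.coe_mk, AddHom.coe_mk, Derivation.map_one_eq_zero,
      AddMonoidAlgebra.single_zero, zero_add]
    refine sum_mem fun v hv => ?_
    have hvV := hg v (Finsupp.mem_support_iff.1 hv)
    beta_reduce
    rw [← AddMonoidAlgebra.smul_single]
    refine zsmul_mem (single_one_mem_laurentSub fun u hu => ?_) _
    by_contra hu'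
    refine hu ?_
    have h1 : v ≠ u := by rintro rfl; exact hu' (hV hvV)
    have h2 : (v.1, v.2 + 1) ≠ u := by rintro rfl; exact hu' (hV' v hvV)
    have h3 : g u = 0 := by
      by_contra h3
      exact hu' (hV (hg u h3))
    simp [h1, h2, h3]

/-- Laurent monomials are algebraic over the variables, so the transcendence degree of
`laurentSub U V` is at most the number of derivatives involved. -/
theorem card_le_of_algebraicIndependent_of_mem_laurentSub {ι : Type} [Fintype ι]
    (U : Finset (σ × ℕ)) (V : Finset (Fin n × ℕ)) {x : ι → LaurentDiffPoly n (DiffPoly σ ℚ)}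
    (hx : AlgebraicIndependent ℚ x)
    (hmem : ∀ i, x i ∈ laurentSub (U : Set (σ × ℕ)) (V : Set (Fin n × ℕ))) :
    Fintype.card ι ≤ U.card + V.card := by
  classical
  let L := LaurentDiffPoly n (DiffPoly σ ℚ)
  let y : Fin n × ℕ → ℤ → L := fun v e => AddMonoidAlgebra.single (Finsupp.single v e) 1
  let s : Finset L := U.image (fun w => AddMonoidAlgebra.single 0 (MvPolynomial.X w)) ∪
    V.image (fun v => y v 1)
  let B := Algebra.adjoin ℚ (s : Set L)
  let C := (Subalgebra.algebraicClosure B L).restrictScalars ℚ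
  have hBC : ∀ z ∈ s, z ∈ C := fun z hz =>
    isAlgebraic_algebraMap (R := B) (A := L) (⟨z, Algebra.subset_adjoin hz⟩ : B)
  have hy : ∀ v ∈ V, ∀ e : ℤ, y v e ∈ C := by
    intro v hv e
    have hy1 : y v 1 ∈ C :=
      hBC _ (Finset.mem_union_right _ (Finset.mem_image_of_mem _ hv))
    have hpow : ∀ (e : ℤ) (k : ℕ), y v e ^ k = y v (k * e) := by
      intro e k
      change AddMonoidAlgebra.single _ _ ^ k = AddMonoidAlgebra.single _ _
      rw [AddMonoidAlgebra.single_pow, one_pow, Finsupp.smul_single, nsmul_eq_mul]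
    have hinv : y v (-1) ∈ C := by
      refine IsAlgebraic.of_mul (y := y v 1) (mem_nonZeroDivisors_of_ne_zero ?_) hy1 ?_
      · exact AddMonoidAlgebra.single_ne_zero.2 one_ne_zero
      · have h1 : y v 1 * y v (-1) = 1 := by
          change AddMonoidAlgebra.single _ _ * AddMonoidAlgebra.single _ _ = _
          rw [AddMonoidAlgebra.single_mul_single, ← Finsupp.single_add, add_neg_cancel,
            Finsupp.single_zero, one_mul]
          rfl
        rw [h1]
        exact isAlgebraic_one
    obtain ⟨k, rfl | rfl⟩ := e.eq_nat_or_neg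
    · simpa [hpow] using pow_mem hy1 k
    · simpa [hpow] using pow_mem hinv k
  have hle : laurentSub (U : Set (σ × ℕ)) (V : Set (Fin n × ℕ)) ≤ C := by
    refine Algebra.adjoin_le ?_
    rintro _ (⟨w, hw, rfl⟩ | ⟨g, hg, rfl⟩)
    · exact hBC _ (Finset.mem_union_left _ (Finset.mem_image_of_mem _ hw))
    · have h1 : (AddMonoidAlgebra.single g 1 : L) = ∏ v ∈ g.support, y v (g v) := by
        have h2 := map_prod (AddMonoidAlgebra.of (DiffPoly σ ℚ) (LaurentExp n))
          (fun v => Multiplicative.ofAdd (Finsupp.single v (g v))) g.support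
        rw [← ofAdd_sum] at h2
        change AddMonoidAlgebra.single (g.sum Finsupp.single) 1 = _ at h2
        rwa [Finsupp.sum_single] at h2
      change AddMonoidAlgebra.single g 1 ∈ C
      rw [h1]
      exact prod_mem fun v hv => hy v (hg v (Finsupp.mem_support_iff.1 hv)) _
  have hcl : Set.range x ⊆ (AlgebraicIndependent.matroid ℚ L).closure (s : Set L) := by
    rw [AlgebraicIndependent.matroid_closure_eq]
    rintro _ ⟨i, rfl⟩
    exact hle (hmem i)
  have hind : (AlgebraicIndependent.matroid ℚ L).Indep (Set.range x) :=
    AlgebraicIndependent.matroid_indep_iff.2 hx.to_subtype_range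
  have h1 : (Set.range x).encard ≤ (s : Set L).encard := by
    rw [← hind.eRk_eq_encard]
    refine ((AlgebraicIndependent.matroid ℚ L).eRk_mono hcl).trans ?_
    rw [Matroid.eRk_closure_eq]
    exact Matroid.eRk_le_encard _ _
  rw [Set.encard_coe_eq_coe_finsetCard, ← Set.image_univ,
    hx.injective.injOn.encard_image, Set.encard_univ, ENat.card_eq_coe_fintype_card] at h1
  have h2 : Fintype.card ι ≤ s.card := by exact_mod_cast h1
  exact h2.trans ((Finset.card_union_le _ _).trans
    (add_le_add Finset.card_image_le Finset.card_image_le))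

end

/-! ### Elimination -/

theorem iterate_derivation_mem_diffIdeal {R : Type} [CommRing R] [Algebra ℚ R]
    (δ : Derivation ℚ R R) (S : Set R) {x : R} (hx : x ∈ diffIdeal δ S) (m : ℕ) :
    δ^[m] x ∈ diffIdeal δ S := by
  induction m with
  | zero => exact hx
  | succ m ih =>
    rw [Function.iterate_succ_apply']
    generalize δ^[m] x = y at ih
    refine Submodule.span_induction ?_ (by simp) (fun a b _ _ ha hb => ?_) (fun a b hb' hb => ?_) ih
    · rintro _ ⟨s, hs, k, rfl⟩
      exact Ideal.subset_span ⟨s, hs, k + 1, (Function.iterate_succ_apply' _ _ _).symm⟩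
    · rw [map_add]
      exact add_mem ha hb
    · rw [smul_eq_mul, Derivation.leibniz, smul_eq_mul, smul_eq_mul]
      exact add_mem (Ideal.mul_mem_left _ _ hb) (Ideal.mul_mem_right _ _ hb')

section

variable {n : ℕ} {l : Fin (n + 1) → ℕ} (α : ∀ i, Fin (l i + 1) → LaurentExp n)

/-- The value `ζ_i = -∑_{k ≠ 0} u_{ik} M_{ik} / M_{i0}` of `u_{i0}` that makes `ℙ_i` vanish. -/
noncomputable def genericSolution (i : Fin (n + 1)) :
    LaurentDiffPoly n (DiffPoly (CoeffIdx l) ℚ) :=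
  -∑ k ∈ Finset.univ.erase 0,
    AddMonoidAlgebra.single (α i k - α i 0)
      (MvPolynomial.X (⟨i, k⟩, 0) : DiffPoly (CoeffIdx l) ℚ)

/-- The values of the derivatives of the `u_{ik}` at the generic zero of the system: `u_{i0}` goes
to `ζ_i`, the other `u_{ik}` to themselves. -/
noncomputable def genericPoint (w : CoeffIdx l × ℕ) :
    LaurentDiffPoly n (DiffPoly (CoeffIdx l) ℚ) :=
  if w.1.2 = 0 then (laurentDeriv n (polyDeriv (CoeffIdx l)))^[w.2] (genericSolution α w.1.1)
  else AddMonoidAlgebra.single 0 (MvPolynomial.X w)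

/-- The set of the derivatives of the `y_j` on which the quotients `M_{ik} / M_{i0}` and their
derivatives of order at most `m` depend. -/
def involved (i : Fin (n + 1)) (m : ℕ) : Set (Fin n × ℕ) :=
  {v | ∃ k, ∃ u : Fin n × ℕ, α i k u ≠ α i 0 u ∧ ∃ m' ≤ m, v = (u.1, u.2 + m')}

theorem single_X_sub_genericSolution_mem (i : Fin (n + 1)) :
    AddMonoidAlgebra.single 0 (MvPolynomial.X (⟨i, 0⟩, 0)) - genericSolution α i ∈
      diffIdeal (laurentDeriv n (polyDeriv (CoeffIdx l))) (Set.range (genericPoly α)) := by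
  have h : AddMonoidAlgebra.single 0 (MvPolynomial.X (⟨i, 0⟩, 0)) - genericSolution α i =
      AddMonoidAlgebra.single (-α i 0) 1 * genericPoly α i := by
    rw [genericSolution, genericPoly, Finset.mul_sum,
      ← Finset.add_sum_erase _ _ (Finset.mem_univ (0 : Fin (l i + 1))), sub_neg_eq_add]
    simp only [AddMonoidAlgebra.single_mul_single, one_mul, neg_add_cancel, neg_add_eq_sub]
  rw [h]
  exact Ideal.mul_mem_left _ _ (Ideal.subset_span ⟨_, ⟨i, rfl⟩, 0, rfl⟩)

/-- Relations between the coordinates of the generic zero lie in the elimination ideal. -/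
theorem mem_elimIdeal_of_aeval_eq_zero {f : DiffPoly (CoeffIdx l) ℚ}
    (hf : MvPolynomial.aeval (genericPoint α) f = 0) : f ∈ elimIdeal α := by
  set I := diffIdeal (laurentDeriv n (polyDeriv (CoeffIdx l))) (Set.range (genericPoly α)) with hI
  have h : ((Ideal.Quotient.mk I).comp (AddMonoidAlgebra.singleZeroRingHom :
      DiffPoly (CoeffIdx l) ℚ →+* LaurentDiffPoly n (DiffPoly (CoeffIdx l) ℚ))) =
      (Ideal.Quotient.mk I).comp
        (MvPolynomial.aeval (R := ℚ) (genericPoint α)).toRingHom := by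
    refine MvPolynomial.ringHom_ext (fun r => ?_) (fun w => ?_)
    · exact DFunLike.congr_fun (Subsingleton.elim (((Ideal.Quotient.mk I).comp
        (AddMonoidAlgebra.singleZeroRingHom)).comp MvPolynomial.C) (((Ideal.Quotient.mk I).comp
        (MvPolynomial.aeval (R := ℚ) (genericPoint α)).toRingHom).comp MvPolynomial.C)) r
    · obtain ⟨⟨i, k⟩, m⟩ := w
      change Ideal.Quotient.mk I (AddMonoidAlgebra.single 0 (MvPolynomial.X (⟨i, k⟩, m))) =
        Ideal.Quotient.mk I (MvPolynomial.aeval (genericPoint α) (MvPolynomial.X (⟨i, k⟩, m)))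
      rw [MvPolynomial.aeval_X, genericPoint, Ideal.Quotient.eq]
      dsimp only
      split_ifs with hk
      · rw [show k = 0 from hk]
        have h1 := iterate_derivation_mem_diffIdeal _ _ (single_X_sub_genericSolution_mem α i) m
        rwa [iterate_map_sub, iterate_laurentDeriv_single_zero, iterate_polyDeriv_X] at h1
      · simp
  have h1 := DFunLike.congr_fun h f
  change Ideal.Quotient.mk I (AddMonoidAlgebra.singleZeroRingHom f) =
    Ideal.Quotient.mk I (MvPolynomial.aeval (genericPoint α) f) at h1
  rw [hf, map_zero, Ideal.Quotient.eq_zero_iff_mem] at h1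
  exact h1

theorem iterate_genericSolution_mem (i : Fin (n + 1)) (m : ℕ) :
    (laurentDeriv n (polyDeriv (CoeffIdx l)))^[m] (genericSolution α i) ∈
      laurentSub {w : CoeffIdx l × ℕ | w.1.1 = i ∧ w.1.2 ≠ 0 ∧ w.2 ≤ m} (involved α i m) := by
  induction m with
  | zero =>
    refine neg_mem (sum_mem fun k hk => ?_)
    have h1 : (AddMonoidAlgebra.single (α i k - α i 0) (MvPolynomial.X (⟨i, k⟩, 0)) :
        LaurentDiffPoly n (DiffPoly (CoeffIdx l) ℚ)) =
        AddMonoidAlgebra.single 0 (MvPolynomial.X (⟨i, k⟩, 0)) *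
          AddMonoidAlgebra.single (α i k - α i 0) 1 := by
      rw [AddMonoidAlgebra.single_mul_single, zero_add, mul_one]
    rw [h1]
    refine mul_mem (single_X_mem_laurentSub ⟨rfl, Finset.ne_of_mem_erase hk, le_rfl⟩)
      (single_one_mem_laurentSub fun v hv => ⟨k, v, ?_, 0, le_rfl, rfl⟩)
    exact fun h => hv (by simp [h])
  | succ m ih =>
    rw [Function.iterate_succ_apply']
    refine laurentDeriv_mem_laurentSub ?_ ?_ ?_ ?_ ih
    · exact fun w hw => ⟨hw.1, hw.2.1, hw.2.2.trans m.le_succ⟩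
    · rintro v ⟨k, u, hu, m', hm', rfl⟩
      exact ⟨k, u, hu, m', hm'.trans m.le_succ, rfl⟩
    · exact fun w hw => ⟨hw.1, hw.2.1, Nat.succ_le_succ hw.2.2⟩
    · rintro v ⟨k, u, hu, m', hm', rfl⟩
      exact ⟨k, u, hu, m' + 1, Nat.succ_le_succ hm', rfl⟩

/-- If fewer than `∑ H_i` derivatives of the `y_j` are involved in the first `H_i` derivatives of
the `ℙ_i`, these derivatives can be eliminated: the elimination ideal contains a nonzero polynomial
in the derivatives of order less than `H_i` of the `u_{ik}`. -/
theorem exists_mem_elimIdeal_of_card_lt (H : Fin (n + 1) → ℕ) (V : Finset (Fin n × ℕ))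
    (hV : ∀ i k v m, α i k v ≠ α i 0 v → m < H i → (v.1, v.2 + m) ∈ V)
    (hcard : V.card < ∑ i, H i) :
    ∃ f : DiffPoly (CoeffIdx l) ℚ, f ≠ 0 ∧ f ∈ elimIdeal α ∧
      ∀ w ∈ f.vars, w.2 < H w.1.1 := by
  classical
  -- the derivatives of order less than `H_i` of the `u_{ik}` with `k ≠ 0`
  let U : Finset (CoeffIdx l × ℕ) := ((Finset.univ : Finset (CoeffIdx l)) ×ˢ
    Finset.range (∑ i, H i)).filter fun w => w.1.2 ≠ 0 ∧ w.2 < H w.1.1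
  have hU : ∀ w : CoeffIdx l × ℕ, w ∈ U ↔ w.1.2 ≠ 0 ∧ w.2 < H w.1.1 := by
    intro w
    simp only [U, Finset.mem_filter, Finset.mem_product, Finset.mem_univ, true_and,
      Finset.mem_range, and_iff_right_iff_imp]
    exact fun h => h.2.trans_le (Finset.single_le_sum (fun _ _ => Nat.zero_le _)
      (Finset.mem_univ w.1.1))
  let j : ((Σ i, Fin (H i)) ⊕ U) → CoeffIdx l × ℕ :=
    Sum.elim (fun z => (⟨z.1, 0⟩, z.2)) Subtype.val
  have hj : Function.Injective j := by
    refine Function.Injective.sumElim ?_ Subtype.val_injective ?_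
    · rintro ⟨i, m⟩ ⟨i', m'⟩ h
      simp only [Prod.mk.injEq, Sigma.mk.injEq] at h
      obtain ⟨⟨rfl, -⟩, h2⟩ := h
      rw [Fin.ext h2]
    · rintro z ⟨u, hu⟩ h
      obtain rfl : ((⟨z.1, 0⟩, (z.2 : ℕ)) : CoeffIdx l × ℕ) = u := h
      exact ((hU _).1 hu).1 rfl
  have hjH : ∀ z, (j z).2 < H (j z).1.1 := by
    rintro (⟨i, m⟩ | ⟨u, hu⟩)
    · exact m.2
    · exact ((hU u).1 hu).2
  have hdep : ¬ AlgebraicIndependent ℚ (fun z => genericPoint α (j z)) := by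
    intro hind
    have h1 := card_le_of_algebraicIndependent_of_mem_laurentSub U V hind (by
      rintro (⟨i, m⟩ | ⟨u, hu⟩)
      · change genericPoint α (⟨i, 0⟩, (m : ℕ)) ∈ _
        rw [genericPoint, if_pos rfl]
        refine laurentSub_mono ?_ ?_ (iterate_genericSolution_mem α i m)
        · rintro w ⟨rfl, hw, hm⟩
          exact (hU w).2 ⟨hw, hm.trans_lt m.2⟩
        · rintro _ ⟨k, u, hu, m', hm', rfl⟩
          exact hV i k u m' hu (hm'.trans_lt m.2)
      · change genericPoint α u ∈ _
        rw [genericPoint, if_neg ((hU u).1 hu).1]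
        exact single_X_mem_laurentSub hu)
    simp only [Fintype.card_sum, Fintype.card_sigma, Fintype.card_fin, Fintype.card_coe] at h1
    omega
  -- a relation between the coordinates is the required polynomial
  rw [algebraicIndependent_iff] at hdep
  push Not at hdep
  obtain ⟨p, hp, hp0⟩ := hdep
  refine ⟨MvPolynomial.rename j p, ?_, ?_, ?_⟩
  · rwa [Ne, map_eq_zero_iff _ (MvPolynomial.rename_injective j hj)]
  · refine mem_elimIdeal_of_aeval_eq_zero α ?_
    rw [MvPolynomial.aeval_rename]
    exact hp
  · intro w hw
    obtain ⟨z, -, rfl⟩ := Finset.mem_image.1 (MvPolynomial.vars_rename j p hw)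
    exact hjH z

/-! ### The order matrix -/

/-- A derivative in which the exponents of two terms of `ℙ_i` differ occurs in the norm form. -/
theorem mem_vars_normForm (hα : ∀ i, Function.Injective (α i)) (i : Fin (n + 1))
    {k : Fin (l i + 1)} {v : Fin n × ℕ} (h : α i k v ≠ α i 0 v) :
    v ∈ (normForm (genericPoly α i)).vars := by
  classical
  set F := genericPoly α i with hF
  have hcoeff : ∀ k, F.coeff (α i k) ≠ 0 := by
    intro k
    rw [hF, genericPoly, AddMonoidAlgebra.coeff_sum, Finsupp.finsetSum_apply,
      Finset.sum_eq_single k]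
    · simp
    · intro k' _ hk'
      rw [AddMonoidAlgebra.coeff_single, Finsupp.single_apply, if_neg fun e => hk' (hα i e)]
    · simp
  have hmem : ∀ k, α i k ∈ F.coeff.support := fun k => Finsupp.mem_support_iff.2 (hcoeff k)
  have hmin : ∀ g ∈ F.coeff.support, minExp F ≤ g := by
    intro g hg
    rw [minExp, dif_pos ⟨g, hg⟩]
    exact Finset.inf'_le id hg
  -- one of the two exponents exceeds the minimum
  obtain ⟨g, hg, hlt⟩ : ∃ g ∈ F.coeff.support, minExp F v < g v := by
    by_contra hcon
    push Not at hcon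
    have h1 := fun k => le_antisymm (hcon _ (hmem k)) (hmin _ (hmem k) v)
    exact h ((h1 k).trans (h1 0).symm)
  -- `Int.toNat` does not truncate here, so distinct terms have distinct exponents in the norm form
  let e : LaurentExp n → (Fin n × ℕ →₀ ℕ) := fun g =>
    Finsupp.mapRange Int.toNat Int.toNat_zero (g - minExp F)
  have he : ∀ g ∈ F.coeff.support, ∀ g' ∈ F.coeff.support, e g = e g' → g = g' := by
    intro g hg g' hg' heq
    ext u
    have h1 := DFunLike.congr_fun heq u
    have h2 := hmin g hg u
    have h3 := hmin g' hg' u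
    simp only [e, Finsupp.mapRange_apply, Finsupp.sub_apply] at h1
    omega
  refine (MvPolynomial.mem_vars_iff_mem_support _).2 ⟨e g, ?_, ?_⟩
  · rw [MvPolynomial.mem_support_iff, normForm, MvPolynomial.coeff_sum, Finset.sum_eq_single g]
    · rw [MvPolynomial.coeff_monomial, if_pos rfl]
      exact Finsupp.mem_support_iff.1 hg
    · intro g' hg' hne
      rw [MvPolynomial.coeff_monomial, if_neg fun h => hne (he g' hg' g hg h)]
    · exact fun h => absurd hg h
  · rw [Finsupp.mem_support_iff]
    simp only [e, Finsupp.mapRange_apply, Finsupp.sub_apply]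
    omega

theorem le_orderMatrix (hα : ∀ i, Function.Injective (α i)) (i : Fin (n + 1))
    {k : Fin (l i + 1)} {v : Fin n × ℕ} (h : α i k v ≠ α i 0 v) :
    ∃ e : ℕ, orderMatrix α i v.1 = (e : WithBot ℕ) ∧ v.2 ≤ e := by
  have h1 := le_ord (mem_vars_normForm α hα i h)
  obtain ⟨e, he⟩ := WithBot.ne_bot_iff_exists.1
    ((WithBot.bot_lt_coe v.2).trans_le h1).ne'
  rw [← he] at h1
  exact ⟨e, he.symm, WithBot.coe_le_coe.1 h1⟩

theorem minOrder_le_of_mem_vars {i : Fin (n + 1)} {j : Fin n} {k : ℕ}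
    (h : (j, k) ∈ (normForm (genericPoly α i)).vars) : minOrder α j ≤ k := by
  obtain ⟨m, hm, hv⟩ := (MvPolynomial.mem_vars_iff_mem_support _).1 h
  have h1 : 0 < (normForm (genericPoly α i)).degreeOf (j, k) :=
    (Nat.pos_of_ne_zero (Finsupp.mem_support_iff.1 hv)).trans_le
      (MvPolynomial.monomial_le_degreeOf (j, k) hm)
  exact Nat.sInf_le ⟨i, h1⟩

theorem minOrder_le_of_orderMatrix_eq {i : Fin (n + 1)} {j : Fin n} {e : ℕ}
    (h : orderMatrix α i j = (e : WithBot ℕ)) : minOrder α j ≤ e :=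
  minOrder_le_of_mem_vars α (mem_vars_of_ord_eq h)

/-! ### The bounds -/

variable {α}

/-- A nonzero element of the elimination ideal bounds the order of the resultant. -/
theorem ordBlock_le {R f : DiffPoly (CoeffIdx l) ℚ} (hR : IsSparseDiffResultant α R)
    (hf : f ≠ 0) (hfα : f ∈ elimIdeal α) (i : Fin (n + 1)) (b : WithBot ℕ)
    (hb : ∀ w ∈ f.vars, w.1.1 = i → (w.2 : WithBot ℕ) ≤ b) : ordBlock R i ≤ b := by
  refine Finset.sup_le fun k _ => ?_
  refine (ord_le_ord_of_forall_mem_sat hR.1 hf (fun r => ?_) _).trans (Finset.sup_le fun w hw => ?_)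
  · rw [← hR.2 r]
    exact hfα
  · split_ifs with h
    · exact hb w hw (by rw [h])
    · exact bot_le

/-- On a Hall violator the polynomials outnumber the indeterminates they involve, so elimination
succeeds with derivatives of large order and without the `i`-th polynomial. -/
theorem ordBlock_eq_bot (hα : ∀ i, Function.Injective (α i)) {R : DiffPoly (CoeffIdx l) ℚ}
    (hR : IsSparseDiffResultant α R) {i : Fin (n + 1)} (h : systemJacobi α i = ⊥) :
    ordBlock R i = ⊥ := by
  classical
  obtain ⟨S, hS⟩ := exists_violator_of_jacobiNumber_eq_bot _ h
  set T := S.biUnion fun k => Finset.univ.filter fun j =>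
    (orderMatrix α).submatrix i.succAbove id k j ≠ ⊥ with hT
  let E : ℕ := ∑ i, ∑ j, (orderMatrix α i j).unbotD 0
  have hE : ∀ i j (e : ℕ), orderMatrix α i j = (e : WithBot ℕ) → e ≤ E := by
    intro i j e he
    have h1 : (orderMatrix α i j).unbotD 0 = e := by rw [he]; rfl
    rw [← h1]
    exact (Finset.single_le_sum (f := fun j => (orderMatrix α i j).unbotD 0)
      (fun _ _ => Nat.zero_le _) (Finset.mem_univ j)).trans
      (Finset.single_le_sum (f := fun i => ∑ j, (orderMatrix α i j).unbotD 0)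
        (fun _ _ => Nat.zero_le _) (Finset.mem_univ i))
  -- the number of derivatives is large enough for `T.card * (N + E) < S.card * N`
  let N := T.card * E + 1
  obtain ⟨f, hf, hfα, hvars⟩ := exists_mem_elimIdeal_of_card_lt α
    (Fin.insertNth i 0 fun k => if k ∈ S then N else 0) (T ×ˢ Finset.range (N + E)) (by
      intro i' k v m hv hm
      rcases Fin.eq_self_or_eq_succAbove i i' with rfl | ⟨r, rfl⟩
      · simp at hm
      · rw [Fin.insertNth_apply_succAbove] at hm
        obtain ⟨e, he, hve⟩ := le_orderMatrix α hα _ hv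
        split_ifs at hm with hr
        · refine Finset.mem_product.2 ⟨Finset.mem_biUnion.2 ⟨r, hr, ?_⟩, ?_⟩
          · refine Finset.mem_filter.2 ⟨Finset.mem_univ _, ?_⟩
            rw [Matrix.submatrix_apply, id, he]
            exact WithBot.coe_ne_bot
          · have := hE _ _ _ he
            rw [Finset.mem_range]
            omega
        · omega) (by
      rw [Fin.sum_univ_succAbove _ i]
      simp only [Fin.insertNth_apply_same, Fin.insertNth_apply_succAbove, zero_add,
        Finset.sum_ite_mem, Finset.univ_inter, Finset.sum_const, smul_eq_mul, Finset.card_product,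
        Finset.card_range]
      calc T.card * (N + E) < (T.card + 1) * N := by simp only [N]; ring_nf; omega
        _ ≤ S.card * N := Nat.mul_le_mul_right _ hS)
  refine le_bot_iff.1 (ordBlock_le hR hf hfα i ⊥ fun w hw hwi => ?_)
  have h1 := hvars w hw
  rw [hwi, Fin.insertNth_apply_same] at h1
  exact absurd h1 (Nat.not_lt_zero _)

theorem sum_minOrder_le {i : Fin (n + 1)} {J : ℕ} (h : systemJacobi α i = (J : WithBot ℕ)) :
    ∑ j, minOrder α j ≤ J := by
  obtain ⟨σ, e, he, rfl⟩ := exists_perm_of_jacobiNumber_eq h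
  rw [← Equiv.sum_comp σ]
  exact Finset.sum_le_sum fun k _ => minOrder_le_of_orderMatrix_eq α (he k)

/-- Elimination with `J_i - γ + 1` derivatives of `ℙ_i`, where `γ` is the sum of the minimal orders,
and with as many derivatives of the other polynomials as the row potentials prescribe after a shift
by a large constant. -/
theorem ordBlock_le_sub (hα : ∀ i, Function.Injective (α i)) {R : DiffPoly (CoeffIdx l) ℚ}
    (hR : IsSparseDiffResultant α R) {i : Fin (n + 1)} {J : ℕ}
    (h : systemJacobi α i = (J : WithBot ℕ)) :
    ordBlock R i ≤ ((J - ∑ j, minOrder α j : ℕ) : WithBot ℕ) := by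
  classical
  -- the subtraction in the statement does not truncate
  have hγ := sum_minOrder_le h
  set γ := ∑ j, minOrder α j with hγdef
  obtain ⟨p, q, hpq, hval⟩ := exists_potentials h
  -- after the shift by `c`, row `i` with potential `J - γ + 1` is admissible as well
  obtain ⟨c, hcp, hcq, hci⟩ : ∃ c : ℤ, (∀ k, 0 ≤ p k + c) ∧
      (∀ j, (minOrder α j : ℤ) ≤ q j + c) ∧
      ∀ j (e : ℕ), orderMatrix α i j = (e : WithBot ℕ) → (e : ℤ) + (J - γ + 1) ≤ q j + c := by
    let E : Fin n → ℕ := fun j => (orderMatrix α i j).unbotD 0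
    have hP := fun k => Finset.single_le_sum (f := fun k => |p k|) (fun _ _ => abs_nonneg _)
      (Finset.mem_univ k)
    have hQ := fun k => Finset.single_le_sum (f := fun k => |q k|) (fun _ _ => abs_nonneg _)
      (Finset.mem_univ k)
    have hE := fun k => Finset.single_le_sum (f := fun j => (E j : ℤ))
      (fun _ _ => Int.natCast_nonneg _) (Finset.mem_univ k)
    have hO := fun k => Finset.single_le_sum (f := fun j => (minOrder α j : ℤ))
      (fun _ _ => Int.natCast_nonneg _) (Finset.mem_univ k)
    have hP0 : 0 ≤ ∑ k, |p k| := Finset.sum_nonneg fun _ _ => abs_nonneg _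
    have hQ0 : 0 ≤ ∑ k, |q k| := Finset.sum_nonneg fun _ _ => abs_nonneg _
    have hE0 : 0 ≤ ∑ j, (E j : ℤ) := Finset.sum_nonneg fun _ _ => Int.natCast_nonneg _
    have hγ' : (γ : ℤ) = ∑ j, (minOrder α j : ℤ) := by rw [hγdef]; push_cast; rfl
    refine ⟨∑ k, |p k| + ∑ k, |q k| + ∑ j, (E j : ℤ) + J + 1, fun k => ?_, fun j => ?_,
      fun j e he => ?_⟩
    · have := hP k
      have := neg_abs_le (p k)
      omega
    · have := hQ j
      have := neg_abs_le (q j)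
      have := hO j
      omega
    · have := hQ j
      have := neg_abs_le (q j)
      have := hE j
      have h1 : E j = e := by simp only [E, he]; rfl
      simp only [h1] at this
      omega
  obtain ⟨f, hf, hfα, hvars⟩ := exists_mem_elimIdeal_of_card_lt α
    (Fin.insertNth i (J - γ + 1) fun k => (p k + c).toNat)
    ((Finset.univ.sigma fun j => Finset.Ico (minOrder α j) (q j + c).toNat).map
      (Equiv.sigmaEquivProd (Fin n) ℕ).toEmbedding) (by
      intro i' k v m hv hm
      obtain ⟨e, he, hve⟩ := le_orderMatrix α hα _ hv
      have hmin := minOrder_le_of_mem_vars α (mem_vars_normForm α hα i' hv)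
      refine Finset.mem_map.2 ⟨⟨v.1, v.2 + m⟩, ?_, rfl⟩
      rw [Finset.mem_sigma]
      refine ⟨Finset.mem_univ _, Finset.mem_Ico.2 ⟨by dsimp only; omega, ?_⟩⟩
      dsimp only
      rcases Fin.eq_self_or_eq_succAbove i i' with rfl | ⟨r, rfl⟩
      · rw [Fin.insertNth_apply_same] at hm
        have := hci _ _ he
        omega
      · rw [Fin.insertNth_apply_succAbove] at hm
        have := hpq r v.1 e he
        omega) (by
      rw [Fin.sum_univ_succAbove _ i]
      simp only [Fin.insertNth_apply_same, Fin.insertNth_apply_succAbove, Finset.card_map,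
        Finset.card_sigma, Nat.card_Ico]
      have h1 : ∀ j, (((q j + c).toNat - minOrder α j : ℕ) : ℤ) = q j + c - minOrder α j := by
        intro j
        have := hcq j
        omega
      have h2 : ∀ k, (((p k + c).toNat : ℕ) : ℤ) = p k + c := fun k => Int.toNat_of_nonneg (hcp k)
      have hγ' : (γ : ℤ) = ∑ j, (minOrder α j : ℤ) := by rw [hγdef]; push_cast; rfl
      zify [hγ]
      simp only [h1, h2, Finset.sum_sub_distrib, Finset.sum_add_distrib, ← hγ']
      linarith)
  refine ordBlock_le hR hf hfα i _ fun w hw hwi => ?_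
  have h1 := hvars w hw
  rw [hwi, Fin.insertNth_apply_same] at h1
  exact WithBot.coe_le_coe.2 (Nat.lt_succ_iff.1 h1)

end

end SparseDiffRes

theorem mainTheorem6 (n : ℕ) (l : Fin (n + 1) → ℕ) (hl : ∀ i, 1 ≤ l i)
    (α : ∀ i, Fin (l i + 1) → SparseDiffRes.LaurentExp n)
    (hα : ∀ i, Function.Injective (α i))
    (hess : SparseDiffRes.LaurentDiffEssential α)
    (R : SparseDiffRes.DiffPoly (SparseDiffRes.CoeffIdx l) ℚ)
    (hR : SparseDiffRes.IsSparseDiffResultant α R) (i : Fin (n + 1)) :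
    (SparseDiffRes.systemJacobi α i = ⊥ → SparseDiffRes.ordBlock R i = ⊥) ∧
    (0 ≤ SparseDiffRes.systemJacobi α i →
      SparseDiffRes.ordBlock R i ≤ SparseDiffRes.systemJacobi α i ∧
      SparseDiffRes.ordBlock R i + ((∑ j, SparseDiffRes.minOrder α j : ℕ) : WithBot ℕ) ≤
        SparseDiffRes.systemJacobi α i) := by
  refine ⟨SparseDiffRes.ordBlock_eq_bot hα hR, fun h0 => ?_⟩
  obtain ⟨J, hJ⟩ := WithBot.ne_bot_iff_exists.1 ((WithBot.bot_lt_coe 0).trans_le h0).ne'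
  have hle := SparseDiffRes.ordBlock_le_sub hα hR hJ.symm
  have hγ := SparseDiffRes.sum_minOrder_le hJ.symm
  rw [← hJ]
  refine ⟨hle.trans (WithBot.coe_le_coe.2 (Nat.sub_le _ _)), (add_le_add_left hle _).trans ?_⟩
  rw [← Nat.cast_add, Nat.sub_add_cancel hγ]
  exact le_rfl
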